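/- Let $\mathcal K$ be a (locally small) category. Then $\mathcal K$ is equivalent to a variety if and only if $\mathcal K$ is exact and has a varietal generator. Here the notions are the following. A *variety* is the category of all algebras $A$ (possibly with empty underlying set) of a finitary one-sorted signature $\Sigma$ (a set of operation symbols, each of a finite arity) that satisfy a given set of equations $t=s$ between $\Sigma$-terms, with all homomorphisms as morphisms. A parallel pair $s_0,s_1\colon S\to A$ *factorizes through* a pair $r_0,r_1\colon R\to A$ if there is $f\colon S\to R$ with $s_i=r_i\cdot f$ for $i=0,1$. A *congruence* on an object $A$ is a collectively monic pair $r_0,r_1\colon R\to A$ which is reflexive (there is $d\colon A\to R$ with $r_0\cdot d=\mathrm{id}_A=r_1\cdot d$), symmetric (the pair $r_1,r_0$ factorizes through $r_0,r_1$) and transitive (given $s,s',s''\colon S\to A$ such that both $s,s'$ and $s',s''$ factorize through $r_0,r_1$, so does $s,s''$). A category is *exact* (in the sense of Barr) if (1) every morphism has a kernel pair and every kernel pair has a coequalizer; (2) congruences are effective: every congruence is the kernel pair of some morphism; (3) regular epimorphisms (coequalizers of parallel pairs) are stable under pullback: in every pullback square with sides $e\colon A\to Q$ and $f\colon B\to Q$,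 if $e$ is a regular epimorphism, then so is the projection to $B$. No finite limits beyond kernel pairs are assumed to exist. An object $G$ *has copowers* if for every set $M$ the coproduct $M\cdot G=\coprod_{M}G$ exists. A *varietal generator* is an object $G$ with copowers which is (a) a *strong generator*: for every object $X$ the canonical morphism $[f]\colon \mathcal K(G,X)\cdot G\to X$, whose component at $f\colon G\to X$ is $f$, is an extremal epimorphism (an epimorphism that does not factorize through any proper subobject of $X$); (b) *abstractly finite*: for every set $M$ every morphism $G\to M\cdot G$ factorizes through the morphism $M_0\cdot G\to M\cdot G$ induced by the inclusion of some finite subset $M_0\subseteq M$; (c) a *regular projective*: for every regular epimorphism $e\colon X\to Y$ every morphism $G\to Y$ factorizes through $e$. -/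

import Mathlib

open CategoryTheory CategoryTheory.Limits

universe u v

namespace VarietyChar

/-! ### Finitary one-sorted varieties -/

section Variety

open FirstOrder

/-- An equation in the signature `L`: a pair of terms over a countable set of variables. -/
abbrev Equation (L : FirstOrder.Language.{v, 0}) : Type v := L.Term ℕ × L.Term ℕ

/-- An `L`-algebra satisfies an equation if both sides agree under every interpretation of the
variables. -/
def Satisfies (L : FirstOrder.Language.{v, 0}) (A : Type v) [L.Structure A] (e : Equation L) :
    Prop :=
  ∀ h : ℕ → A, e.1.realize h = e.2.realize h

/-- The objects of the variety presented by the set `E` of equations in the signature `L`: all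
(possibly empty) small `L`-algebras that satisfy the equations in `E`. It is used for signatures
`L` without relation symbols. -/
structure VarietyObj (L : FirstOrder.Language.{v, 0}) (E : Set (Equation L)) : Type (v + 1) where
  /-- The underlying set. -/
  carrier : Type v
  /-- The operations. -/
  [str : L.Structure carrier]
  /-- Every equation in `E` holds. -/
  sat : ∀ e ∈ E, Satisfies L carrier e

attribute [instance] VarietyObj.str

/-- The morphisms of a variety are all homomorphisms of algebras. -/
instance varietyCategory (L : FirstOrder.Language.{v, 0}) (E : Set (Equation L)) :
    Category.{v} (VarietyObj L E) where
  Hom A B := A.carrier →[L] B.carrier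
  id A := FirstOrder.Language.Hom.id L A.carrier
  comp f g := FirstOrder.Language.Hom.comp g f

end Variety

/-- `K` is equivalent to a variety: there are a signature of finitary operation symbols
(a small set of them, no relation symbols) and a set of equations presenting a variety that is
equivalent, as a category, to `K`. -/
def IsEquivalentToVariety (K : Type u) [Category.{v} K] : Prop :=
  ∃ (L : FirstOrder.Language.{v, 0}) (_ : L.IsAlgebraic) (E : Set (Equation L)),
    Nonempty (K ≌ VarietyObj L E)

/-! ### Barr-exact categories -/

section Exact

variable {K : Type u} [Category.{v} K]

/-- The parallel pair `s₀, s₁` factorizes through the parallel pair `r₀, r₁`. -/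
def FactorsThroughPair {R S A : K} (r₀ r₁ : R ⟶ A) (s₀ s₁ : S ⟶ A) : Prop :=
  ∃ f : S ⟶ R, f ≫ r₀ = s₀ ∧ f ≫ r₁ = s₁

/-- A congruence on `A`: a collectively monic parallel pair that is reflexive, symmetric and
transitive. No pullbacks are required to exist. -/
structure IsCongruence {R A : K} (r₀ r₁ : R ⟶ A) : Prop where
  /-- The pair is a relation. -/
  collectively_monic : ∀ ⦃S : K⦄ (f g : S ⟶ R), f ≫ r₀ = g ≫ r₀ → f ≫ r₁ = g ≫ r₁ → f = g
  /-- There is a joint splitting. -/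
  reflexive : ∃ d : A ⟶ R, d ≫ r₀ = 𝟙 A ∧ d ≫ r₁ = 𝟙 A
  /-- The opposite pair factorizes through the given one. -/
  symmetric : FactorsThroughPair r₀ r₁ r₁ r₀
  /-- Transitivity, on generalized elements. -/
  transitive : ∀ ⦃S : K⦄ (s s' s'' : S ⟶ A), FactorsThroughPair r₀ r₁ s s' →
    FactorsThroughPair r₀ r₁ s' s'' → FactorsThroughPair r₀ r₁ s s''

/-- Barr-exactness. Beyond kernel pairs, finite limits are not required. -/
structure IsBarrExact (K : Type u) [Category.{v} K] : Prop where
  /-- Every morphism has a kernel pair. -/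
  hasKernelPair : ∀ ⦃X Y : K⦄ (f : X ⟶ Y), HasPullback f f
  /-- Every kernel pair has a coequalizer. -/
  hasCoequalizer_of_isKernelPair : ∀ ⦃R X Y : K⦄ (f : X ⟶ Y) (r₀ r₁ : R ⟶ X),
    IsKernelPair f r₀ r₁ → HasCoequalizer r₀ r₁
  /-- Congruences are effective: each one is the kernel pair of some morphism. -/
  effective : ∀ ⦃R A : K⦄ (r₀ r₁ : R ⟶ A), IsCongruence r₀ r₁ →
    ∃ (B : K) (f : A ⟶ B), IsKernelPair f r₀ r₁
  /-- Regular epimorphisms are stable under all existing pullbacks. -/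
  regularEpi_stable : ∀ ⦃P A B Q : K⦄ (f' : P ⟶ A) (e' : P ⟶ B) (e : A ⟶ Q) (f : B ⟶ Q),
    IsPullback f' e' e f → IsRegularEpi e → IsRegularEpi e'

end Exact

/-! ### Varietal generators -/

section Generator

variable {K : Type u} [Category.{v} K]

/-- `G` has copowers: the coproduct of `M` copies of `G` exists for every small set `M`. -/
class HasCopowers (G : K) : Prop where
  hasCoproduct : ∀ M : Type v, HasCoproduct (fun _ : M => G)

attribute [instance] HasCopowers.hasCoproduct

variable (G : K) [HasCopowers G]

/-- The copower `M · G`. -/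
noncomputable abbrev copower (M : Type v) : K := ∐ (fun _ : M => G)

/-- The morphism `u · G : M₀ · G ⟶ M · G` induced by a map `u : M₀ → M`. -/
noncomputable def copowerMap {M₀ M : Type v} (w : M₀ → M) : copower G M₀ ⟶ copower G M :=
  Sigma.desc (fun i => Sigma.ι (fun _ : M => G) (w i))

/-- The canonical morphism `[f] : K(G, X) · G ⟶ X`, whose component at `f : G ⟶ X` is `f`. -/
noncomputable def canonicalMor (X : K) : copower G (G ⟶ X) ⟶ X :=
  Sigma.desc (fun f : G ⟶ X => f)

/-- `G` is a strong generator: every canonical morphism is an extremal epimorphism. -/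
def IsStrongGen : Prop :=
  ∀ X : K, ExtremalEpi (canonicalMor G X)

/-- `G` is abstractly finite: every morphism from `G` to a copower `M · G` factorizes through
`M₀ · G` for a finite subset `M₀` of `M`. -/
def IsAbstractlyFinite : Prop :=
  ∀ (M : Type v) (f : G ⟶ copower G M), ∃ (M₀ : Finset M) (g : G ⟶ copower G {x // x ∈ M₀}),
    g ≫ copowerMap G (fun x : {x // x ∈ M₀} => (x : M)) = f

/-- `G` is a regular projective: morphisms out of `G` lift through regular epimorphisms. -/
def IsRegularProjective (G : K) : Prop :=
  ∀ ⦃X Y : K⦄ (e : X ⟶ Y), IsRegularEpi e → ∀ g : G ⟶ Y, ∃ h : G ⟶ X, h ≫ e = g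

/-- A varietal generator: a strong generator with copowers that is an abstractly finite regular
projective. -/
def IsVarietalGenerator (G : K) : Prop :=
  ∃ _ : HasCopowers G, IsStrongGen G ∧ IsAbstractlyFinite G ∧ IsRegularProjective G

end Generator

end VarietyChar

namespace VarietyChar

/-! ### Generalized elements at a generator -/

section Points

variable {K : Type u} [Category.{v} K] {G : K} [HasCopowers G]

/-! Think of the morphisms `G ⟶ X` as the points of `X`. A strong generator separates morphisms by
points, and a regular projective lifts points along regular epimorphisms. In an exact category the
canonical morphism from `K(G, X) · G` to `X` is then a regular epimorphism, so morphisms out of `X`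
can be defined on points (`exists_hom_of_points`).

The points of `X` form an algebra whose n-ary operations are the morphisms from `G` to `n · G`; take
the variety given by all equations valid in these algebras. Abstract finiteness makes every morphism
`G ⟶ M · G` a term over `M`, so a homomorphism between point algebras respects the relations that
present `X`, which gives fullness. For essential surjectivity, evaluating terms maps the points of
`|A| · G` onto the algebra `A`. The kernel of this map consists of the points of a congruence, and
the points of its quotient are `A`. Products and pullbacks are not available, so the congruence is
built as a joint image (`exists_joint_image`), itself an effective quotient.

Conversely, in a variety let `G` be free on one generator. Points are then elements, regular
epimorphisms are the surjections, and copowers of `G` are free algebras whose elements are terms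
with finitely many variables. Everything reduces to computations with elements. -/

@[simp]
theorem ι_canonicalMor (X : K) (x : G ⟶ X) :
    Sigma.ι (fun _ : (G ⟶ X) => G) x ≫ canonicalMor G X = x := by
  simp [canonicalMor]

@[simp]
theorem ι_canonicalMor_assoc (X : K) (x : G ⟶ X) {Y : K} (f : X ⟶ Y) :
    Sigma.ι (fun _ : (G ⟶ X) => G) x ≫ canonicalMor G X ≫ f = x ≫ f := by
  rw [← Category.assoc, ι_canonicalMor]

theorem copowerMap_desc {M₀ M : Type v} (w : M₀ → M) {X : K} (q : M → (G ⟶ X)) :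
    copowerMap G w ≫ Sigma.desc q = Sigma.desc (fun i => q (w i)) := by
  apply Sigma.hom_ext
  intro i
  simp [copowerMap]

/-- Morphisms agree if they agree on all points of a strong generator. -/
theorem IsStrongGen.hom_ext (hs : IsStrongGen G) {X Y : K} {f g : X ⟶ Y}
    (h : ∀ x : G ⟶ X, x ≫ f = x ≫ g) : f = g := by
  have := hs X
  rw [← cancel_epi (canonicalMor G X)]
  apply Sigma.hom_ext
  intro x
  simpa using h x

theorem IsStrongGen.mono_of_points (hs : IsStrongGen G) {X Y : K} {m : X ⟶ Y}
    (h : ∀ x y : G ⟶ X, x ≫ m = y ≫ m → x = y) : Mono m :=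
  ⟨fun f g e => hs.hom_ext fun x => h _ _ (by simp [e])⟩

/-- A morphism out of the target of a regular epimorphism can be defined on points. -/
theorem IsStrongGen.exists_desc (hs : IsStrongGen G) {X Q Z : K} (e : X ⟶ Q) (he : IsRegularEpi e)
    (k : X ⟶ Z) (h : ∀ x y : G ⟶ X, x ≫ e = y ≫ e → x ≫ k = y ≫ k) : ∃ l : Q ⟶ Z, e ≫ l = k := by
  refine ⟨IsRegularEpi.desc e k (hs.hom_ext fun x => ?_), IsRegularEpi.fac e k _⟩
  simpa using h (x ≫ IsRegularEpi.left e) (x ≫ IsRegularEpi.right e)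
    (by simp [IsRegularEpi.w])

variable (hK : IsBarrExact K) (hs : IsStrongGen G) (hp : IsRegularProjective G)

-- Coequalize the kernel pair of `f`. Two points of the quotient with equal image in `Y` lift to `X`
-- by projectivity; the lifts form a point of the kernel pair, so the quotient already identifies
-- them.
include hK hs hp in
theorem exists_regularEpi_mono_factorization {X Y : K} (f : X ⟶ Y) :
    ∃ (Q : K) (e : X ⟶ Q) (m : Q ⟶ Y), IsRegularEpi e ∧ Mono m ∧ e ≫ m = f := by
  have := hK.hasKernelPair f
  have hk := IsKernelPair.of_hasPullback f
  have := hK.hasCoequalizer_of_isKernelPair f _ _ hk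
  refine ⟨_, coequalizer.π (pullback.fst f f) (pullback.snd f f),
    coequalizer.desc f pullback.condition, inferInstance, hs.mono_of_points fun x y h => ?_,
    by simp⟩
  obtain ⟨x', rfl⟩ := hp (coequalizer.π _ _) inferInstance x
  obtain ⟨y', rfl⟩ := hp (coequalizer.π _ _) inferInstance y
  simp only [Category.assoc, coequalizer.π_desc] at h
  rw [← pullback.lift_fst x' y' h, Category.assoc, coequalizer.condition, ← Category.assoc,
    pullback.lift_snd]

include hK hs hp in
theorem isRegularEpi_of_extremalEpi {X Y : K} (f : X ⟶ Y) [ExtremalEpi f] : IsRegularEpi f := by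
  obtain ⟨Q, e, m, he, hm, rfl⟩ := exists_regularEpi_mono_factorization hK hs hp f
  have : IsIso m := ExtremalEpi.isIso (e ≫ m) e m rfl
  exact ⟨⟨RegularEpi.ofArrowIso (Arrow.isoMk' e (e ≫ m) (Iso.refl _) (asIso m)) (IsRegularEpi.getStruct e)⟩⟩

include hK hs hp in
/-- A morphism can be defined on points. -/
theorem exists_hom_of_points {X Y : K} (h : (G ⟶ X) → (G ⟶ Y))
    (hh : ∀ t t' : G ⟶ copower G (G ⟶ X), t ≫ canonicalMor G X = t' ≫ canonicalMor G X →
      t ≫ Sigma.desc h = t' ≫ Sigma.desc h) : ∃ k : X ⟶ Y, ∀ x, x ≫ k = h x := by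
  have := hs X
  obtain ⟨k, hk⟩ := hs.exists_desc (canonicalMor G X)
    (isRegularEpi_of_extremalEpi hK hs hp _) (Sigma.desc h) hh
  refine ⟨k, fun x => ?_⟩
  rw [← ι_canonicalMor_assoc, hk, Sigma.ι_desc]

include hK hs hp in
/-- Factorization through a collectively monic pair can be tested on points. -/
theorem factorsThroughPair_of_points {R A S : K} {r₀ r₁ : R ⟶ A} {s₀ s₁ : S ⟶ A}
    (hr : ∀ f g : G ⟶ R, f ≫ r₀ = g ≫ r₀ → f ≫ r₁ = g ≫ r₁ → f = g)
    (h : ∀ x : G ⟶ S, FactorsThroughPair r₀ r₁ (x ≫ s₀) (x ≫ s₁)) :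
    FactorsThroughPair r₀ r₁ s₀ s₁ := by
  choose l hl₀ hl₁ using h
  have e₀ : Sigma.desc l ≫ r₀ = canonicalMor G S ≫ s₀ := by
    apply Sigma.hom_ext
    intro x
    simp [hl₀]
  have e₁ : Sigma.desc l ≫ r₁ = canonicalMor G S ≫ s₁ := by
    apply Sigma.hom_ext
    intro x
    simp [hl₁]
  obtain ⟨k, hk⟩ := exists_hom_of_points hK hs hp l fun t t' htt => by
    apply hr
    · simp only [Category.assoc, e₀, reassoc_of% htt]
    · simp only [Category.assoc, e₁, reassoc_of% htt]
  exact ⟨k, hs.hom_ext fun x => by rw [reassoc_of% hk x, hl₀],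
    hs.hom_ext fun x => by rw [reassoc_of% hk x, hl₁]⟩

include hK hs hp in
/-- A pair of morphisms has a joint kernel pair. -/
theorem exists_joint_kernelPair {X Y : K} (p₀ p₁ : X ⟶ Y) :
    ∃ (E : K) (r₀ r₁ : E ⟶ X),
      (∀ ⦃S : K⦄ (f g : S ⟶ E), f ≫ r₀ = g ≫ r₀ → f ≫ r₁ = g ≫ r₁ → f = g) ∧
      ∀ ⦃S : K⦄ (s s' : S ⟶ X),
        FactorsThroughPair r₀ r₁ s s' ↔ s ≫ p₀ = s' ≫ p₀ ∧ s ≫ p₁ = s' ≫ p₁ := by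
  have := hK.hasKernelPair p₀
  let k₀ := pullback.fst p₀ p₀
  let k₁ := pullback.snd p₀ p₀
  have hk : k₀ ≫ p₀ = k₁ ≫ p₀ := pullback.condition
  -- This replaces an equalizer: the image of the copower of all points of the kernel pair of `p₀`
  -- that `p₁` does not separate.
  let T := {x : G ⟶ pullback p₀ p₀ // x ≫ k₀ ≫ p₁ = x ≫ k₁ ≫ p₁}
  obtain ⟨E, e, m, he, hm, hem⟩ := exists_regularEpi_mono_factorization hK hs hp
    (Sigma.desc (fun x : T => x.1))
  have hmu : m ≫ k₀ ≫ p₁ = m ≫ k₁ ≫ p₁ := by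
    rw [← cancel_epi e, reassoc_of% hem, reassoc_of% hem]
    apply Sigma.hom_ext
    intro x
    simpa using x.2
  refine ⟨E, m ≫ k₀, m ≫ k₁, fun S f g h₀ h₁ => ?_, fun S s s' => ⟨?_, ?_⟩⟩
  · rw [← cancel_mono m]
    apply pullback.hom_ext
    · simpa using h₀
    · simpa using h₁
  · rintro ⟨f, rfl, rfl⟩
    simp [hk, hmu]
  · rintro ⟨h₀, h₁⟩
    -- Doubling `m` turns factorization through one monomorphism into a case of factorization
    -- through a pair.
    obtain ⟨f, hf, -⟩ : FactorsThroughPair m m (pullback.lift s s' h₀) (pullback.lift s s' h₀) := by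
      apply factorsThroughPair_of_points hK hs hp
      · intro f g h _
        exact (cancel_mono m).1 h
      · intro x
        let t : T := ⟨x ≫ pullback.lift s s' h₀, by
          simp only [Category.assoc, k₀, k₁, pullback.lift_fst_assoc, pullback.lift_snd_assoc, h₁]⟩
        have : (Sigma.ι (fun _ : T => G) t ≫ e) ≫ m = x ≫ pullback.lift s s' h₀ := by
          simp [hem, t]
        exact ⟨_, this, this⟩
    refine ⟨f, ?_, ?_⟩
    · rw [reassoc_of% hf]; exact pullback.lift_fst _ _ _
    · rw [reassoc_of% hf]; exact pullback.lift_snd _ _ _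

include hK hs hp in
/-- A pair of morphisms has a joint image. -/
theorem exists_joint_image {X Y : K} (p₀ p₁ : X ⟶ Y) :
    ∃ (Q : K) (q : X ⟶ Q) (r₀ r₁ : Q ⟶ Y), IsRegularEpi q ∧ q ≫ r₀ = p₀ ∧ q ≫ r₁ = p₁ ∧
      ∀ x y : G ⟶ Q, x ≫ r₀ = y ≫ r₀ → x ≫ r₁ = y ≫ r₁ → x = y := by
  obtain ⟨E, r₀, r₁, hr, hE⟩ := exists_joint_kernelPair hK hs hp p₀ p₁
  have hw := (hE r₀ r₁).1 ⟨𝟙 _, by simp, by simp⟩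
  have hcong : IsCongruence r₀ r₁ :=
    { collectively_monic := hr
      reflexive := (hE (𝟙 X) (𝟙 X)).2 ⟨rfl, rfl⟩
      symmetric := (hE r₁ r₀).2 ⟨hw.1.symm, hw.2.symm⟩
      transitive := fun S s s' s'' h h' => by
        rw [hE] at h h' ⊢
        exact ⟨h.1.trans h'.1, h.2.trans h'.2⟩ }
  obtain ⟨B, f, hf⟩ := hK.effective r₀ r₁ hcong
  have := hK.hasCoequalizer_of_isKernelPair f _ _ hf
  refine ⟨_, coequalizer.π r₀ r₁, coequalizer.desc p₀ hw.1, coequalizer.desc p₁ hw.2,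
    inferInstance, by simp, by simp, fun x y h₀ h₁ => ?_⟩
  obtain ⟨x', rfl⟩ := hp (coequalizer.π _ _) inferInstance x
  obtain ⟨y', rfl⟩ := hp (coequalizer.π _ _) inferInstance y
  simp only [Category.assoc, coequalizer.π_desc] at h₀ h₁
  obtain ⟨z, rfl, rfl⟩ := (hE x' y').2 ⟨h₀, h₁⟩
  rw [Category.assoc, coequalizer.condition, Category.assoc]

end Points

/-! ### The variety of a varietal generator -/

section Algebras

open FirstOrder

variable {K : Type u} [Category.{v} K] (G : K) [HasCopowers G]

/-- The signature whose `n`-ary operations are the morphisms from `G` to its `n`-th copower. -/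
noncomputable def opLanguage : FirstOrder.Language.{v, 0} where
  Functions n := G ⟶ copower G (ULift.{v} (Fin n))
  Relations _ := Empty

instance : (opLanguage G).IsAlgebraic := fun _ => inferInstanceAs (IsEmpty Empty)

noncomputable instance pointsStructure (X : K) : (opLanguage G).Structure (G ⟶ X) where
  funMap {n} (σ : G ⟶ copower G (ULift.{v} (Fin n))) x := σ ≫ Sigma.desc (fun i => x i.down)
  RelMap r _ := r.elim

/-- The equations that hold in all algebras of points. -/
def pointsEquations : Set (Equation (opLanguage G)) :=
  {e | ∀ X : K, Satisfies (opLanguage G) (G ⟶ X) e}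

/-- The variety generated by the algebras of points. -/
abbrev PointsVariety := VarietyObj (opLanguage G) (pointsEquations G)

/-- The functor sending an object to its algebra of points. -/
noncomputable def pointsFunctor : K ⥤ PointsVariety G where
  obj X := { carrier := G ⟶ X, sat := fun _ he => he X }
  map {X Y} f :=
    show (G ⟶ X) →[opLanguage G] (G ⟶ Y) from
    { toFun := fun x => x ≫ f
      map_fun' := fun {n} (σ : G ⟶ copower G (ULift.{v} (Fin n))) x => by
        change (σ ≫ Sigma.desc _) ≫ f = σ ≫ Sigma.desc _
        rw [Category.assoc]
        congr 1
        apply Sigma.hom_ext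
        intro i
        simp
      map_rel' := fun r => r.elim }
  map_id X := by
    apply FirstOrder.Language.Hom.ext
    exact fun x => Category.comp_id x
  map_comp f g := by
    apply FirstOrder.Language.Hom.ext
    exact fun x => (Category.assoc x f g).symm

variable {G}

/-- Terms with equal interpretations in all algebras of points agree in the whole variety. -/
theorem realize_eq_of_points (A : PointsVariety G) {β : Type v} {s t : (opLanguage G).Term β}
    (h : ∀ (X : K) (q : β → (G ⟶ X)), s.realize q = t.realize q) (w : β → A.carrier) :
    s.realize w = t.realize w := by
  classical
  let S : Finset β := s.varFinset ∪ t.varFinset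
  -- Equations only have variables in `ℕ`, so the finitely many variables that occur are renamed
  -- injectively.
  let i : β → ℕ := fun b => if hb : b ∈ S then (S.equivFin ⟨b, hb⟩ : ℕ) else 0
  have hi : Set.InjOn i S := by
    intro a ha b hb hab
    have ha' : a ∈ S := ha
    have hb' : b ∈ S := hb
    simp only [i, ha', hb', dif_pos] at hab
    simpa using S.equivFin.injective (Fin.ext hab)
  -- Algebras may be empty, so the default value for the other variables has to come from a term.
  let a₀ : A.carrier := s.realize w
  let g : ℕ → A.carrier := fun n => if hn : ∃ b ∈ S, i b = n then w hn.choose else a₀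
  have hg : ∀ b ∈ S, g (i b) = w b := by
    intro b hb
    have hn : ∃ b' ∈ S, i b' = i b := ⟨b, hb, rfl⟩
    simp only [g, dif_pos hn]
    rw [hi hn.choose_spec.1 hb hn.choose_spec.2]
  have key := A.sat (s.relabel i, t.relabel i) (fun X q => by simpa using h X (q ∘ i)) g
  simp only [FirstOrder.Language.Term.realize_relabel] at key
  have aux : ∀ r : (opLanguage G).Term β, r.varFinset ⊆ S →
      r.realize (g ∘ i) = r.realize w := by
    intro r hr
    rw [← FirstOrder.Language.Term.realize_restrictVar (t := r) (f := Subtype.val)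
        (v := g ∘ i) (g ∘ i) (fun _ => rfl),
      ← FirstOrder.Language.Term.realize_restrictVar (t := r) (f := Subtype.val)
        (v := g ∘ i) w (fun b => (hg _ (hr b.2)))]
  rwa [aux s Finset.subset_union_left, aux t Finset.subset_union_right] at key

/-- A morphism from an abstractly finite object to a copower is a term. -/
theorem IsAbstractlyFinite.exists_term (hf : IsAbstractlyFinite G) {M : Type v}
    (t : G ⟶ copower G M) :
    ∃ τ : (opLanguage G).Term M, ∀ (X : K) (q : M → (G ⟶ X)),
      τ.realize q = t ≫ Sigma.desc q := by
  obtain ⟨M₀, g, rfl⟩ := hf M t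
  refine ⟨.func (l := M₀.card) (g ≫ copowerMap G (fun i => ULift.up (M₀.equivFin i)) :
    G ⟶ copower G (ULift.{v} (Fin M₀.card))) (fun j => .var (M₀.equivFin.symm j)),
    fun X q => ?_⟩
  change (g ≫ copowerMap G _) ≫ Sigma.desc _ = _
  rw [Category.assoc, Category.assoc, copowerMap_desc, copowerMap_desc]
  simp

theorem realize_comp {M : Type v} (τ : (opLanguage G).Term M) {X Y : K} (q : M → (G ⟶ X))
    (f : X ⟶ Y) : τ.realize q ≫ f = τ.realize (fun m => q m ≫ f) :=
  (FirstOrder.Language.HomClass.realize_term (F := (G ⟶ X) →[opLanguage G] (G ⟶ Y))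
    (M := G ⟶ X) (N := G ⟶ Y) ((pointsFunctor G).map f) (t := τ) (v := q)).symm

theorem pointsFunctor_faithful (hs : IsStrongGen G) : (pointsFunctor G).Faithful where
  map_injective h := hs.hom_ext fun x =>
    congrArg (fun k : (G ⟶ _) →[opLanguage G] (G ⟶ _) => k x) h

/-- A point `t` of `K(G, X) · G` is a term `τ` over the points of `X`. Its image under the canonical
morphism is the value of `τ` in `X`, and a homomorphism commutes with this evaluation. -/
theorem pointsFunctor_full (hK : IsBarrExact K) (hs : IsStrongGen G)
    (hp : IsRegularProjective G) (hf : IsAbstractlyFinite G) : (pointsFunctor G).Full where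
  map_surjective {X Y} h := by
    let h' : (G ⟶ X) →[opLanguage G] (G ⟶ Y) := h
    obtain ⟨k, hk⟩ := exists_hom_of_points hK hs hp h' fun t t' htt => by
      obtain ⟨τ, hτ⟩ := hf.exists_term t
      obtain ⟨τ', hτ'⟩ := hf.exists_term t'
      rw [← hτ, ← hτ']
      have h₁ := FirstOrder.Language.HomClass.realize_term h' (t := τ) (v := id)
      have h₂ := FirstOrder.Language.HomClass.realize_term h' (t := τ') (v := id)
      have h₃ := ((hτ X id).trans htt).trans (hτ' X id).symm
      exact h₁.trans ((congrArg h' h₃).trans h₂.symm)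
    exact ⟨k, FirstOrder.Language.Hom.ext hk⟩

end Algebras

/-! ### Homomorphisms in a variety -/

section Homs

open FirstOrder

variable {L : FirstOrder.Language.{v, 0}} {E : Set (Equation L)}

/-- The homomorphism underlying a morphism of a variety. -/
def homOf {A B : VarietyObj L E} (f : A ⟶ B) : A.carrier →[L] B.carrier := f

@[simp]
theorem homOf_comp {A B C : VarietyObj L E} (f : A ⟶ B) (g : B ⟶ C) (x : A.carrier) :
    homOf (f ≫ g) x = homOf g (homOf f x) := rfl

@[simp]
theorem homOf_id (A : VarietyObj L E) (x : A.carrier) : homOf (𝟙 A) x = x := rfl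

theorem homOf_ext {A B : VarietyObj L E} {f g : A ⟶ B} (h : ∀ x, homOf f x = homOf g x) : f = g :=
  FirstOrder.Language.Hom.ext h

theorem homOf_realize {A B : VarietyObj L E} (f : A ⟶ B) {β : Type*} (t : L.Term β)
    (w : β → A.carrier) : homOf f (t.realize w) = t.realize (fun b => homOf f (w b)) :=
  (FirstOrder.Language.HomClass.realize_term (homOf f)).symm

variable [L.IsAlgebraic]

/-- A map preserving the operations is a morphism of a variety. -/
def mkHom {A B : VarietyObj L E} (f : A.carrier → B.carrier)
    (hf : ∀ {n : ℕ} (σ : L.Functions n) (x : Fin n → A.carrier),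
      f (FirstOrder.Language.Structure.funMap σ x) =
        FirstOrder.Language.Structure.funMap σ (f ∘ x)) : A ⟶ B :=
  show A.carrier →[L] B.carrier from
  { toFun := f
    map_fun' := hf
    map_rel' := fun r => isEmptyElim r }

theorem isIso_of_bijective {A B : VarietyObj L E} (f : A ⟶ B)
    (hf : Function.Bijective (homOf f)) : IsIso f := by
  let e := Equiv.ofBijective _ hf
  have he : ∀ x, homOf f (e.symm x) = x := e.apply_symm_apply
  refine ⟨mkHom e.symm fun σ x => ?_, homOf_ext fun x => e.symm_apply_apply x, homOf_ext he⟩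
  apply hf.1
  rw [he, FirstOrder.Language.Hom.map_fun]
  congr 1
  funext i
  exact (he _).symm

end Homs

/-! ### Every algebra is an algebra of points -/

section EssSurj

open FirstOrder

variable {K : Type u} [Category.{v} K] {G : K} [HasCopowers G]

/-- Every algebra in the variety is the quotient of the points of a copower. -/
theorem IsAbstractlyFinite.exists_evaluation (hf : IsAbstractlyFinite G) (A : PointsVariety G) :
    ∃ α : (G ⟶ copower G A.carrier) → A.carrier,
      (∀ a, α (Sigma.ι (fun _ : A.carrier => G) a) = a) ∧
      ∀ {β : Type v} (s : (opLanguage G).Term β) (q : β → (G ⟶ copower G A.carrier)),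
        α (s.realize q) = s.realize (fun b => α (q b)) := by
  choose τ hτ using fun t : G ⟶ copower G A.carrier => hf.exists_term t
  refine ⟨fun t => (τ t).realize id, fun a => ?_, fun {β} s q => ?_⟩
  · refine realize_eq_of_points A (t := .var a) (fun X q => ?_) id
    rw [hτ, Sigma.ι_desc, FirstOrder.Language.Term.realize_var]
  -- The term chosen for `s.realize q` need not be the substituted term, but both have the same
  -- values in every algebra of points, hence in `A`.
  · have := realize_eq_of_points A (s := τ (s.realize q)) (t := s.subst (fun b => τ (q b)))
      (fun X r => ?_) id
    · rw [FirstOrder.Language.Term.realize_subst] at this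
      exact this
    · rw [hτ, FirstOrder.Language.Term.realize_subst, realize_comp]
      simp only [hτ]

variable (hK : IsBarrExact K) (hs : IsStrongGen G) (hp : IsRegularProjective G)
  (hf : IsAbstractlyFinite G)

include hK hs hp hf in
/-- The kernel of the canonical presentation of an algebra is a congruence of the category. -/
theorem exists_congruence_of_evaluation {F : K} {A : PointsVariety G} (α : (G ⟶ F) → A.carrier)
    (hα : ∀ {β : Type v} (s : (opLanguage G).Term β) (q : β → (G ⟶ F)),
      α (s.realize q) = s.realize (fun b => α (q b))) :
    ∃ (R : K) (r₀ r₁ : R ⟶ F),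
      (∀ x y : G ⟶ R, x ≫ r₀ = y ≫ r₀ → x ≫ r₁ = y ≫ r₁ → x = y) ∧
      ∀ x y : G ⟶ F, FactorsThroughPair r₀ r₁ x y ↔ α x = α y := by
  let N := {p : (G ⟶ F) × (G ⟶ F) // α p.1 = α p.2}
  obtain ⟨R, q, r₀, r₁, hq, h₀, h₁, hr⟩ := exists_joint_image hK hs hp
    (Sigma.desc (fun p : N => p.1.1)) (Sigma.desc (fun p : N => p.1.2))
  refine ⟨R, r₀, r₁, hr, fun x y => ⟨?_, fun h => ?_⟩⟩
  · rintro ⟨z, rfl, rfl⟩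
    -- A point of `R` lifts to `N · G`, where it is a term over `N`; `α` commutes with terms and
    -- identifies the two components of each member of `N`.
    obtain ⟨t, rfl⟩ := hp q hq z
    obtain ⟨τ, hτ⟩ := hf.exists_term t
    rw [Category.assoc, Category.assoc, h₀, h₁, ← hτ, ← hτ, hα, hα]
    congr 1
    funext p
    exact p.2
  · let p : N := ⟨(x, y), h⟩
    refine ⟨Sigma.ι (fun _ : N => G) p ≫ q, ?_, ?_⟩
    · rw [Category.assoc, h₀, Sigma.ι_desc]
    · rw [Category.assoc, h₁, Sigma.ι_desc]

include hK hs hp in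
/-- A relation that is an equivalence relation on points is the kernel of a regular
epimorphism. -/
theorem exists_quotient_of_points {R F : K} {r₀ r₁ : R ⟶ F}
    (hr : ∀ x y : G ⟶ R, x ≫ r₀ = y ≫ r₀ → x ≫ r₁ = y ≫ r₁ → x = y)
    (heq : Equivalence fun x y : G ⟶ F => FactorsThroughPair r₀ r₁ x y) :
    ∃ (B : K) (q : F ⟶ B), IsRegularEpi q ∧
      ∀ x y : G ⟶ F, x ≫ q = y ≫ q ↔ FactorsThroughPair r₀ r₁ x y := by
  have hpt {S : K} {s s' : S ⟶ F} (h : FactorsThroughPair r₀ r₁ s s') (x : G ⟶ S) :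
      FactorsThroughPair r₀ r₁ (x ≫ s) (x ≫ s') := by
    obtain ⟨f, rfl, rfl⟩ := h
    exact ⟨x ≫ f, by simp, by simp⟩
  have hcong : IsCongruence r₀ r₁ :=
    { collectively_monic := fun S f g h₀ h₁ => hs.hom_ext fun x => hr _ _
        (by simp [h₀]) (by simp [h₁])
      reflexive := factorsThroughPair_of_points hK hs hp hr fun x => heq.refl _
      symmetric := factorsThroughPair_of_points hK hs hp hr fun x =>
        heq.symm ⟨x, rfl, rfl⟩
      transitive := fun S s s' s'' h h' => factorsThroughPair_of_points hK hs hp hr fun x =>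
        heq.trans (hpt h x) (hpt h' x) }
  obtain ⟨B, f, hf⟩ := hK.effective r₀ r₁ hcong
  have := hK.hasCoequalizer_of_isKernelPair f _ _ hf
  refine ⟨_, coequalizer.π r₀ r₁, inferInstance, fun x y => ⟨fun h => ?_, ?_⟩⟩
  · have h' : x ≫ f = y ≫ f := by
      rw [← coequalizer.π_desc f hf.w, reassoc_of% h]
    exact ⟨hf.lift x y h', hf.lift_fst _ _ _, hf.lift_snd _ _ _⟩
  · rintro ⟨z, rfl, rfl⟩
    rw [Category.assoc, coequalizer.condition, Category.assoc]

-- Points of the quotient `B` lift to the copower, and two lifts have the same image in `B` exactly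
-- when `α` identifies them, so `α` induces a bijective homomorphism onto `A`.
include hK hs hp hf in
theorem pointsFunctor_essSurj : (pointsFunctor G).EssSurj where
  mem_essImage A := by
    obtain ⟨α, hι, hα⟩ := hf.exists_evaluation A
    obtain ⟨R, r₀, r₁, hr, hR⟩ := exists_congruence_of_evaluation hK hs hp hf α hα
    obtain ⟨B, q, hq, hB⟩ := exists_quotient_of_points hK hs hp hr
      ⟨fun x => (hR x x).2 rfl, fun h => (hR _ _).2 ((hR _ _).1 h).symm,
        fun h h' => (hR _ _).2 (((hR _ _).1 h).trans ((hR _ _).1 h'))⟩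
    choose l hl using hp q hq
    have hφ (x : G ⟶ copower G A.carrier) : α (l (x ≫ q)) = α x :=
      (hR _ _).1 ((hB _ _).1 (hl _))
    let φ : (pointsFunctor G).obj B ⟶ A := mkHom (fun b => α (l b)) fun {n} σ x => by
      obtain ⟨y, rfl⟩ : ∃ y : Fin n → (G ⟶ copower G A.carrier), (fun i => y i ≫ q) = x :=
        ⟨fun i => l (x i), funext fun i => hl _⟩
      have h₁ := realize_comp (.func σ fun i => .var (ULift.up i)) (fun i => y i.down) q
      have h₂ := hα (.func σ fun i => .var (ULift.up i)) (fun i => y i.down)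
      refine (congrArg (fun b => α (l b)) h₁.symm).trans ((hφ _).trans (h₂.trans ?_))
      rw [FirstOrder.Language.Term.realize_func]
      congr 1
      funext i
      exact (hφ _).symm
    have : IsIso φ := isIso_of_bijective φ ⟨fun x y h => by
        rw [← hl x, ← hl y]
        exact (hB _ _).2 ((hR _ _).2 h),
      fun a => ⟨Sigma.ι (fun _ : A.carrier => G) a ≫ q, (hφ _).trans (hι a)⟩⟩
    exact ⟨B, ⟨asIso φ⟩⟩

end EssSurj

theorem isEquivalentToVariety_of_isVarietalGenerator {K : Type u} [Category.{v} K]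
    (hK : IsBarrExact K) {G : K} (hG : IsVarietalGenerator G) : IsEquivalentToVariety K := by
  obtain ⟨_, hs, hf, hp⟩ := hG
  have := pointsFunctor_faithful hs
  have := pointsFunctor_full hK hs hp hf
  have := pointsFunctor_essSurj hK hs hp hf
  have : (pointsFunctor G).IsEquivalence := {}
  exact ⟨opLanguage G, inferInstance, pointsEquations G, ⟨(pointsFunctor G).asEquivalence⟩⟩

/-! ### Quotients, kernels and free algebras in a variety -/

section Constructions

open FirstOrder FirstOrder.Language.Structure

variable {L : FirstOrder.Language.{v, 0}} {E : Set (Equation L)} [L.IsAlgebraic]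

/-- An equivalence relation preserved by the operations makes a structure a prestructure. -/
@[reducible]
def prestructureOfCompatible {A : Type v} [L.Structure A] (s : Setoid A)
    (hs : ∀ {n : ℕ} (σ : L.Functions n) (x y : Fin n → A), (∀ i, s (x i) (y i)) →
      s (funMap σ x) (funMap σ y)) : L.Prestructure s where
  toStructure := inferInstance
  fun_equiv x y h := hs _ x y h
  rel_equiv {_ r} _ _ _ := isEmptyElim r

/-- The quotient of a structure by a compatible equivalence relation under which all equations
become true lies in the variety. -/
theorem exists_quotient_structure {A : Type v} [L.Structure A] (s : Setoid A)
    (hs : ∀ {n : ℕ} (σ : L.Functions n) (x y : Fin n → A), (∀ i, s (x i) (y i)) →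
      s (funMap σ x) (funMap σ y))
    (hE : ∀ e ∈ E, ∀ h : ℕ → A, s (e.1.realize h) (e.2.realize h)) :
    ∃ (Q : VarietyObj L E) (q : A →[L] Q.carrier), Function.Surjective q ∧
      ∀ x y, q x = q y ↔ s x y := by
  let _ := prestructureOfCompatible (L := L) s hs
  refine ⟨{ carrier := Quotient s, sat := fun e he h => ?_ },
    { toFun := Quotient.mk s
      map_fun' := fun σ x => (FirstOrder.Language.funMap_quotient_mk' s σ x).symm
      map_rel' := fun r => isEmptyElim r }, Quotient.mk_surjective, fun x y => Quotient.eq⟩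
  obtain ⟨h', rfl⟩ : ∃ h' : ℕ → A, (fun i => Quotient.mk s (h' i)) = h :=
    ⟨fun i => (h i).out, funext fun i => Quotient.out_eq _⟩
  rw [FirstOrder.Language.Term.realize_quotient_mk', FirstOrder.Language.Term.realize_quotient_mk']
  exact Quotient.sound (hE e he h')

/-- A homomorphism whose kernel contains that of a surjective one factors through it. -/
theorem exists_desc_of_surjective {A B C : VarietyObj L E} (f : A ⟶ B)
    (hf : Function.Surjective (homOf f)) (k : A ⟶ C)
    (h : ∀ x y, homOf f x = homOf f y → homOf k x = homOf k y) : ∃ l : B ⟶ C, f ≫ l = k := by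
  choose r hr using hf
  refine ⟨mkHom (fun b => homOf k (r b)) fun σ x => ?_, homOf_ext fun x => h _ _ (hr _)⟩
  rw [show (fun b => homOf k (r b)) ∘ x = homOf k ∘ fun i => r (x i) from rfl,
    ← FirstOrder.Language.Hom.map_fun]
  apply h
  rw [hr, FirstOrder.Language.Hom.map_fun]
  congr 1
  funext i
  exact (hr _).symm

/-- Pointwise factorization through a jointly injective pair of homomorphisms. -/
theorem exists_lift_of_jointly_injective {R A S : VarietyObj L E} (r₀ r₁ : R ⟶ A) (s₀ s₁ : S ⟶ A)
    (hr : ∀ x y, homOf r₀ x = homOf r₀ y → homOf r₁ x = homOf r₁ y → x = y)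
    (h : ∀ x, ∃ z, homOf r₀ z = homOf s₀ x ∧ homOf r₁ z = homOf s₁ x) :
    FactorsThroughPair r₀ r₁ s₀ s₁ := by
  choose l hl₀ hl₁ using h
  refine ⟨mkHom l fun σ x => ?_, homOf_ext hl₀, homOf_ext hl₁⟩
  apply hr
  · rw [hl₀, FirstOrder.Language.Hom.map_fun, FirstOrder.Language.Hom.map_fun]
    congr 1
    funext i
    exact (hl₀ _).symm
  · rw [hl₁, FirstOrder.Language.Hom.map_fun, FirstOrder.Language.Hom.map_fun]
    congr 1
    funext i
    exact (hl₁ _).symm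

/-- The kernel of a homomorphism is an algebra of the variety. -/
theorem exists_kernel {A B : VarietyObj L E} (f : A ⟶ B) :
    ∃ (R : VarietyObj L E) (r₀ r₁ : R ⟶ A),
      (∀ x y, homOf r₀ x = homOf r₀ y → homOf r₁ x = homOf r₁ y → x = y) ∧
      ∀ x y, homOf f x = homOf f y ↔ ∃ z, homOf r₀ z = x ∧ homOf r₁ z = y := by
  let N := {p : A.carrier × A.carrier // homOf f p.1 = homOf f p.2}
  let _ : L.Structure N :=
    { funMap := fun σ x => ⟨(funMap σ fun i => (x i).1.1, funMap σ fun i => (x i).1.2), by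
        rw [FirstOrder.Language.Hom.map_fun, FirstOrder.Language.Hom.map_fun]
        congr 1
        funext i
        exact (x i).2⟩
      RelMap := fun r => isEmptyElim r }
  let p₀ : N →[L] A.carrier :=
    { toFun := fun p => p.1.1
      map_fun' := fun _ _ => rfl
      map_rel' := fun r => isEmptyElim r }
  let p₁ : N →[L] A.carrier :=
    { toFun := fun p => p.1.2
      map_fun' := fun _ _ => rfl
      map_rel' := fun r => isEmptyElim r }
  refine ⟨{ carrier := N, sat := fun e he h => Subtype.ext (Prod.ext ?_ ?_) }, p₀, p₁,
    fun x y h₀ h₁ => Subtype.ext (Prod.ext h₀ h₁), fun x y => ⟨fun h => ⟨⟨(x, y), h⟩, rfl, rfl⟩, ?_⟩⟩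
  · exact (FirstOrder.Language.HomClass.realize_term p₀).symm.trans
      ((A.sat e he _).trans (FirstOrder.Language.HomClass.realize_term p₀))
  · exact (FirstOrder.Language.HomClass.realize_term p₁).symm.trans
      ((A.sat e he _).trans (FirstOrder.Language.HomClass.realize_term p₁))
  · rintro ⟨z, rfl, rfl⟩
    exact z.2

variable (L) in
/-- The absolutely free algebra of terms. -/
@[reducible]
def termStructure (M : Type v) : L.Structure (L.Term M) where
  funMap σ x := .func σ x
  RelMap r := isEmptyElim r

variable (L E) in
/-- Free algebras exist in a variety. -/
theorem exists_free (M : Type v) :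
    ∃ (F : VarietyObj L E) (ι : M → F.carrier),
      (∀ (A : VarietyObj L E) (w : M → A.carrier), ∃ f : F ⟶ A, ∀ m, homOf f (ι m) = w m) ∧
      ∀ x, ∃ t : L.Term M, t.realize ι = x := by
  let _ := termStructure L M
  have hsubst {β : Type} (t : L.Term β) (h : β → L.Term M) : t.realize h = t.subst h := by
    induction t with
    | var => rfl
    | func σ ts ih =>
      rw [FirstOrder.Language.Term.realize_func]
      simp only [ih]
      rfl
  -- Terms are identified when no algebra of the variety separates them, so no calculus of
  -- derivations is needed.
  let s : Setoid (L.Term M) :=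
    { r := fun t t' => ∀ (A : VarietyObj L E) (w : M → A.carrier), t.realize w = t'.realize w
      iseqv := ⟨fun _ _ _ => rfl, fun h A w => (h A w).symm,
        fun h h' A w => (h A w).trans (h' A w)⟩ }
  obtain ⟨F, q, hq, hs⟩ := exists_quotient_structure (E := E) s
    (fun σ x y h A w => by
      change FirstOrder.Language.Term.realize w (.func σ x) =
        FirstOrder.Language.Term.realize w (.func σ y)
      rw [FirstOrder.Language.Term.realize_func, FirstOrder.Language.Term.realize_func]
      congr 1
      funext i
      exact h i A w)
    (fun e he h A w => by
      rw [hsubst, hsubst, FirstOrder.Language.Term.realize_subst,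
        FirstOrder.Language.Term.realize_subst]
      exact A.sat e he _)
  have hreal (t : L.Term M) : t.realize (fun m => q (.var m)) = q t := by
    induction t with
    | var => rfl
    | func σ ts ih =>
      rw [FirstOrder.Language.Term.realize_func]
      simp only [ih]
      exact (q.map_fun σ ts).symm
  refine ⟨F, fun m => q (.var m), fun A w => ?_, fun x => ?_⟩
  · choose r hr using hq
    have hw (t : L.Term M) : (r (q t)).realize w = t.realize w := (hs _ _).1 (hr _) A w
    refine ⟨mkHom (fun x => (r x).realize w) fun σ x => ?_, fun m => hw _⟩
    obtain ⟨y, rfl⟩ : ∃ y : Fin _ → L.Term M, q ∘ y = x :=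
      ⟨fun i => r (x i), funext fun i => hr _⟩
    rw [← FirstOrder.Language.Hom.map_fun, hw]
    refine (FirstOrder.Language.Term.realize_func w σ y).trans ?_
    congr 1
    funext i
    exact (hw _).symm
  · obtain ⟨t, rfl⟩ := hq x
    exact ⟨t, hreal t⟩

end Constructions

/-! ### Categories equivalent to a variety -/

section Equivalent

open FirstOrder FirstOrder.Language.Structure

variable {L : FirstOrder.Language.{v, 0}} {E : Set (Equation L)}
  {K : Type u} [Category.{v} K] (F : K ⥤ VarietyObj L E)

/-- The map underlying the image of a morphism. -/
def mapElt {X Y : K} (f : X ⟶ Y) (x : (F.obj X).carrier) : (F.obj Y).carrier :=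
  homOf (F.map f) x

theorem homOf_map {X Y : K} (f : X ⟶ Y) (x : (F.obj X).carrier) :
    homOf (F.map f) x = mapElt F f x := rfl

@[simp]
theorem mapElt_comp {X Y Z : K} (f : X ⟶ Y) (g : Y ⟶ Z) (x : (F.obj X).carrier) :
    mapElt F (f ≫ g) x = mapElt F g (mapElt F f x) := by
  rw [mapElt, F.map_comp, homOf_comp, homOf_map, homOf_map]

@[simp]
theorem mapElt_id (X : K) (x : (F.obj X).carrier) : mapElt F (𝟙 X) x = x := by
  rw [mapElt, F.map_id, homOf_id]

theorem mapElt_funMap {X Y : K} (f : X ⟶ Y) {n : ℕ} (σ : L.Functions n)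
    (x : Fin n → (F.obj X).carrier) :
    mapElt F f (funMap σ x) = funMap σ fun i => mapElt F f (x i) :=
  (homOf (F.map f)).map_fun σ x

theorem mapElt_realize {X Y : K} (f : X ⟶ Y) {β : Type*} (t : L.Term β)
    (w : β → (F.obj X).carrier) :
    mapElt F f (t.realize w) = t.realize fun b => mapElt F f (w b) :=
  homOf_realize (F.map f) t w

/-- An object freely generated by an element. -/
def IsFreeOn {G : K} (γ : (F.obj G).carrier) : Prop :=
  ∀ (X : K) (x : (F.obj X).carrier), ∃ g : G ⟶ X, mapElt F g γ = x

variable [F.IsEquivalence]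

theorem mapElt_ext {X Y : K} {f g : X ⟶ Y} (h : ∀ x, mapElt F f x = mapElt F g x) : f = g :=
  F.map_injective (homOf_ext h)

variable [L.IsAlgebraic]

/-- Objects freely generated by a set exist. -/
theorem exists_free_object (M : Type v) :
    ∃ (P : K) (ι : M → (F.obj P).carrier),
      (∀ (X : K) (w : M → (F.obj X).carrier), ∃ f : P ⟶ X, ∀ m, mapElt F f (ι m) = w m) ∧
      ∀ x, ∃ t : L.Term M, t.realize ι = x := by
  obtain ⟨A, ι, h₁, h₂⟩ := exists_free L E M
  let i := F.objObjPreimageIso A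
  have hi : ∀ a, homOf i.hom (homOf i.inv a) = a := fun a => by
    rw [← homOf_comp, i.inv_hom_id, homOf_id]
  have hi' : ∀ a, homOf i.inv (homOf i.hom a) = a := fun a => by
    rw [← homOf_comp, i.hom_inv_id, homOf_id]
  refine ⟨F.objPreimage A, fun m => homOf i.inv (ι m), fun X w => ?_, fun x => ?_⟩
  · obtain ⟨f, hf⟩ := h₁ _ w
    refine ⟨F.preimage (i.hom ≫ f), fun m => ?_⟩
    rw [mapElt, F.map_preimage, homOf_comp, hi, hf]
  · obtain ⟨t, ht⟩ := h₂ (homOf i.hom x)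
    refine ⟨t, ?_⟩
    rw [← homOf_realize, ht, hi']

omit [L.IsAlgebraic] in
/-- Two morphisms out of a free object agree if they agree on the generators. -/
theorem hom_ext_of_generators {M : Type v} {P : K} {ι : M → (F.obj P).carrier}
    (hι : ∀ x, ∃ t : L.Term M, t.realize ι = x) {X : K} {f g : P ⟶ X}
    (h : ∀ m, mapElt F f (ι m) = mapElt F g (ι m)) : f = g := by
  apply mapElt_ext F
  intro x
  obtain ⟨t, rfl⟩ := hι x
  rw [mapElt_realize, mapElt_realize]
  congr 1
  exact funext h

theorem exists_quotient_object {X : K} (s : Setoid (F.obj X).carrier)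
    (hs : ∀ {n : ℕ} (σ : L.Functions n) (x y : Fin n → (F.obj X).carrier),
      (∀ i, s (x i) (y i)) → s (funMap σ x) (funMap σ y)) :
    ∃ (Q : K) (q : X ⟶ Q), Function.Surjective (mapElt F q) ∧
      ∀ x y, mapElt F q x = mapElt F q y ↔ s x y := by
  obtain ⟨A, q, hq, hA⟩ := exists_quotient_structure (E := E) s hs
    (fun e he h => by rw [(F.obj X).sat e he h])
  let q' : F.obj X ⟶ A := q
  let i := F.objObjPreimageIso A
  have hi : ∀ a, homOf i.hom (homOf i.inv a) = a := fun a => by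
    rw [← homOf_comp, i.inv_hom_id, homOf_id]
  have hi' : ∀ a, homOf i.inv (homOf i.hom a) = a := fun a => by
    rw [← homOf_comp, i.hom_inv_id, homOf_id]
  have hq' : ∀ x, mapElt F (F.preimage (q' ≫ i.inv)) x = homOf i.inv (q x) := fun x => by
    rw [mapElt, F.map_preimage, homOf_comp]; rfl
  refine ⟨F.objPreimage A, F.preimage (q' ≫ i.inv), fun y => ?_, fun x y => ?_⟩
  · obtain ⟨x, hx⟩ := hq (homOf i.hom y)
    exact ⟨x, by rw [hq', hx, hi']⟩
  · rw [hq', hq', ← hA]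
    exact ⟨fun h => by rw [← hi (q x), h, hi], fun h => by rw [h]⟩

/-- The quotient by the kernel of a morphism. -/
theorem exists_coimage {X Y : K} (f : X ⟶ Y) :
    ∃ (Q : K) (q : X ⟶ Q), Function.Surjective (mapElt F q) ∧
      ∀ x y, mapElt F q x = mapElt F q y ↔ mapElt F f x = mapElt F f y :=
  exists_quotient_object F (Setoid.ker (mapElt F f)) fun σ x y h => by
    rw [Setoid.ker_def, mapElt_funMap, mapElt_funMap]
    congr 1
    exact funext h

theorem exists_desc_object {X Q Z : K} (q : X ⟶ Q) (hq : Function.Surjective (mapElt F q))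
    (k : X ⟶ Z) (h : ∀ x y, mapElt F q x = mapElt F q y → mapElt F k x = mapElt F k y) :
    ∃ l : Q ⟶ Z, q ≫ l = k := by
  obtain ⟨l, hl⟩ := exists_desc_of_surjective (F.map q) hq (F.map k) h
  exact ⟨F.preimage l, F.map_injective (by simpa using hl)⟩

omit [L.IsAlgebraic] in
theorem epi_of_surjective {X Y : K} {f : X ⟶ Y} (hf : Function.Surjective (mapElt F f)) :
    Epi f where
  left_cancellation g h e := mapElt_ext F fun y => by
    obtain ⟨x, rfl⟩ := hf y
    rw [← mapElt_comp, e, mapElt_comp]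

theorem exists_kernelPair {X Y : K} (f : X ⟶ Y) :
    ∃ (R : K) (r₀ r₁ : R ⟶ X),
      (∀ x y, mapElt F r₀ x = mapElt F r₀ y → mapElt F r₁ x = mapElt F r₁ y → x = y) ∧
      ∀ x y, mapElt F f x = mapElt F f y ↔ ∃ z, mapElt F r₀ z = x ∧ mapElt F r₁ z = y := by
  obtain ⟨A, r₀, r₁, h₁, h₂⟩ := exists_kernel (F.map f)
  let i := F.objObjPreimageIso A
  have hi : ∀ a, homOf i.hom (homOf i.inv a) = a := fun a => by
    rw [← homOf_comp, i.inv_hom_id, homOf_id]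
  have hi' : ∀ a, homOf i.inv (homOf i.hom a) = a := fun a => by
    rw [← homOf_comp, i.hom_inv_id, homOf_id]
  refine ⟨F.objPreimage A, F.preimage (i.hom ≫ r₀), F.preimage (i.hom ≫ r₁), ?_, ?_⟩
  · intro x y
    simp only [mapElt, F.map_preimage, homOf_comp]
    intro h h'
    rw [← hi' x, h₁ _ _ h h', hi']
  · intro x y
    simp only [mapElt, F.map_preimage, homOf_comp]
    rw [h₂]
    constructor
    · rintro ⟨z, rfl, rfl⟩
      exact ⟨homOf i.inv z, by rw [hi], by rw [hi]⟩
    · rintro ⟨z, rfl, rfl⟩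
      exact ⟨_, rfl, rfl⟩

/-- Elementwise factorization through a jointly injective pair. -/
theorem factorsThroughPair_of_elements {R A S : K} {r₀ r₁ : R ⟶ A} {s₀ s₁ : S ⟶ A}
    (hr : ∀ x y, mapElt F r₀ x = mapElt F r₀ y → mapElt F r₁ x = mapElt F r₁ y → x = y)
    (h : ∀ x, ∃ z, mapElt F r₀ z = mapElt F s₀ x ∧ mapElt F r₁ z = mapElt F s₁ x) :
    FactorsThroughPair r₀ r₁ s₀ s₁ := by
  obtain ⟨l, h₀, h₁⟩ := exists_lift_of_jointly_injective (F.map r₀) (F.map r₁) (F.map s₀)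
    (F.map s₁) hr h
  exact ⟨F.preimage l, F.map_injective (by simpa using h₀), F.map_injective (by simpa using h₁)⟩

/-- A pair describing the kernel of a morphism elementwise is its kernel pair. -/
theorem isKernelPair_of_elements {R X Y : K} {f : X ⟶ Y} {r₀ r₁ : R ⟶ X}
    (hr : ∀ x y, mapElt F r₀ x = mapElt F r₀ y → mapElt F r₁ x = mapElt F r₁ y → x = y)
    (h : ∀ x y, mapElt F f x = mapElt F f y ↔ ∃ z, mapElt F r₀ z = x ∧ mapElt F r₁ z = y) :
    IsKernelPair f r₀ r₁ := by
  have hl (s : PullbackCone f f) : FactorsThroughPair r₀ r₁ s.fst s.snd :=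
    factorsThroughPair_of_elements F hr fun x => (h _ _).1 (by
      rw [← mapElt_comp, s.condition, mapElt_comp])
  choose l h₀ h₁ using hl
  refine ⟨⟨mapElt_ext F fun z => ?_⟩, ⟨PullbackCone.IsLimit.mk _ l h₀ h₁
    fun s m h₀' h₁' => mapElt_ext F fun x => hr _ _ ?_ ?_⟩⟩
  · rw [mapElt_comp, mapElt_comp]
    exact (h _ _).2 ⟨z, rfl, rfl⟩
  · rw [← mapElt_comp, ← mapElt_comp, h₀, h₀']
  · rw [← mapElt_comp, ← mapElt_comp, h₁, h₁']

theorem isCoequalizer_of_elements {R X Q : K} {q : X ⟶ Q} {r₀ r₁ : R ⟶ X}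
    (hq : Function.Surjective (mapElt F q)) (w : r₀ ≫ q = r₁ ≫ q)
    (h : ∀ x y, mapElt F q x = mapElt F q y → ∃ z, mapElt F r₀ z = x ∧ mapElt F r₁ z = y) :
    Nonempty (IsColimit (Cofork.ofπ q w)) := by
  have := epi_of_surjective F hq
  have hd (s : Cofork r₀ r₁) : ∃ l, q ≫ l = s.π := exists_desc_object F q hq s.π fun x y hxy => by
    obtain ⟨z, rfl, rfl⟩ := h x y hxy
    rw [← mapElt_comp, s.condition, mapElt_comp]
  exact ⟨Cofork.IsColimit.mk _ (fun s => (hd s).choose) (fun s => (hd s).choose_spec)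
    fun s m hm => (cancel_epi q).1 (hm.trans (hd s).choose_spec.symm)⟩

/-- A surjection is the coequalizer of its own kernel pair. -/
theorem isRegularEpi_of_surjective {X Y : K} {f : X ⟶ Y}
    (hf : Function.Surjective (mapElt F f)) : IsRegularEpi f := by
  obtain ⟨R, r₀, r₁, hr, h⟩ := exists_kernelPair F f
  have w := (isKernelPair_of_elements F hr h).w
  obtain ⟨hc⟩ := isCoequalizer_of_elements F hf w fun x y => (h x y).1
  exact ⟨⟨⟨R, r₀, r₁, w, hc⟩⟩⟩

/-! ### Elements as points of a free object on one generator -/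

variable {F} {G : K} {γ : (F.obj G).carrier}

omit [L.IsAlgebraic] [F.IsEquivalence] in
theorem IsFreeOn.injective_of_mono (hG : IsFreeOn F γ) (hγ : ∀ {X : K} {f g : G ⟶ X},
    mapElt F f γ = mapElt F g γ → f = g) {X Y : K} (m : X ⟶ Y) [Mono m] :
    Function.Injective (mapElt F m) := by
  intro x y h
  obtain ⟨f, rfl⟩ := hG X x
  obtain ⟨g, rfl⟩ := hG X y
  rw [(cancel_mono m).1 (hγ (by simpa using h) : f ≫ m = g ≫ m)]

variable (hG : IsFreeOn F γ) (hγ : ∀ {X : K} {f g : G ⟶ X}, mapElt F f γ = mapElt F g γ → f = g)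

include hG hγ

theorem extremalEpi_of_surjective {X Y : K} (f : X ⟶ Y) (hf : Function.Surjective (mapElt F f)) :
    ExtremalEpi f where
  toEpi := epi_of_surjective F hf
  isIso {Z} p i fac hi := by
    have hs : Function.Surjective (mapElt F i) := fun y => by
      obtain ⟨x, rfl⟩ := hf y
      exact ⟨mapElt F p x, by rw [← mapElt_comp, fac]⟩
    have := isIso_of_bijective (F.map i) ⟨hG.injective_of_mono hγ i, hs⟩
    exact isIso_of_reflects_iso i F

-- The comparison from the coimage of `f` to `Y` is monic, and a regular epimorphism is extremal, so
-- the comparison is invertible.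
omit hG hγ in
theorem surjective_of_isRegularEpi {X Y : K} (f : X ⟶ Y) (hf : IsRegularEpi f) :
    Function.Surjective (mapElt F f) := by
  obtain ⟨Q, q, hq, hQ⟩ := exists_coimage F f
  obtain ⟨m, rfl⟩ := exists_desc_object F q hq f fun x y => (hQ x y).1
  have : Mono m := ⟨fun g h e => mapElt_ext F fun x => by
    obtain ⟨a, ha⟩ := hq (mapElt F g x)
    obtain ⟨b, hb⟩ := hq (mapElt F h x)
    rw [← ha, ← hb]
    apply (hQ _ _).2
    rw [mapElt_comp, mapElt_comp, ha, hb, ← mapElt_comp, e, mapElt_comp]⟩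
  have : IsIso m := ExtremalEpi.isIso (q ≫ m) q m rfl
  intro y
  obtain ⟨x, hx⟩ := hq (mapElt F (inv m) y)
  refine ⟨x, ?_⟩
  rw [mapElt_comp, hx, ← mapElt_comp, IsIso.inv_hom_id, mapElt_id]

theorem isBarrExact_of_equivalence : IsBarrExact K where
  hasKernelPair X Y f := by
    obtain ⟨R, r₀, r₁, hr, h⟩ := exists_kernelPair F f
    exact (isKernelPair_of_elements F hr h).hasPullback
  hasCoequalizer_of_isKernelPair R X Y f r₀ r₁ hk := by
    obtain ⟨Q, q, hq, hQ⟩ := exists_coimage F f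
    have w : r₀ ≫ q = r₁ ≫ q := mapElt_ext F fun z => by
      rw [mapElt_comp, mapElt_comp, hQ, ← mapElt_comp, hk.w, mapElt_comp]
    obtain ⟨hc⟩ := isCoequalizer_of_elements F hq w fun x y h => by
      rw [hQ] at h
      obtain ⟨a, rfl⟩ := hG X x
      obtain ⟨b, rfl⟩ := hG X y
      have hab : a ≫ f = b ≫ f := hγ (by simpa using h)
      exact ⟨mapElt F (hk.lift a b hab) γ, by rw [← mapElt_comp, hk.lift_fst],
        by rw [← mapElt_comp, hk.lift_snd]⟩
    exact ⟨⟨_, hc⟩⟩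
  effective R A r₀ r₁ h := by
    have hr : ∀ x y, mapElt F r₀ x = mapElt F r₀ y → mapElt F r₁ x = mapElt F r₁ y → x = y := by
      intro x y h₀ h₁
      obtain ⟨a, rfl⟩ := hG R x
      obtain ⟨b, rfl⟩ := hG R y
      rw [h.collectively_monic a b (hγ (by simpa using h₀)) (hγ (by simpa using h₁))]
    let s : Setoid (F.obj A).carrier :=
      { r := fun x y => ∃ z, mapElt F r₀ z = x ∧ mapElt F r₁ z = y
        iseqv :=
          { refl := fun x => by
              obtain ⟨d, h₀, h₁⟩ := h.reflexive
              exact ⟨mapElt F d x, by rw [← mapElt_comp, h₀, mapElt_id],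
                by rw [← mapElt_comp, h₁, mapElt_id]⟩
            symm := by
              rintro _ _ ⟨z, rfl, rfl⟩
              obtain ⟨f, h₀, h₁⟩ := h.symmetric
              exact ⟨mapElt F f z, by rw [← mapElt_comp, h₀], by rw [← mapElt_comp, h₁]⟩
            trans := by
              rintro _ _ _ ⟨z, rfl, rfl⟩ ⟨z', hz, rfl⟩
              -- Elements are traded for points so that transitivity can be applied with test object
              -- `G`.
              obtain ⟨a, rfl⟩ := hG R z
              obtain ⟨b, rfl⟩ := hG R z'
              obtain ⟨f, h₀, h₁⟩ := h.transitive (a ≫ r₀) (a ≫ r₁) (b ≫ r₁) ⟨a, rfl, rfl⟩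
                ⟨b, hγ (by simpa using hz), rfl⟩
              exact ⟨mapElt F f γ, by rw [← mapElt_comp, h₀, mapElt_comp],
                by rw [← mapElt_comp, h₁, mapElt_comp]⟩ } }
    obtain ⟨Q, q, -, hQ⟩ := exists_quotient_object F s fun σ x y hxy => by
      choose z h₀ h₁ using hxy
      refine ⟨funMap σ z, ?_, ?_⟩
      · rw [mapElt_funMap]
        congr 1
        exact funext h₀
      · rw [mapElt_funMap]
        congr 1
        exact funext h₁
    exact ⟨Q, q, isKernelPair_of_elements F hr hQ⟩
  regularEpi_stable P A B Q f' e' e f sq he := by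
    apply isRegularEpi_of_surjective F
    intro y
    obtain ⟨x, hx⟩ := surjective_of_isRegularEpi (F := F) e he (mapElt F f y)
    obtain ⟨a, rfl⟩ := hG A x
    obtain ⟨b, rfl⟩ := hG B y
    have hab : a ≫ e = b ≫ f := hγ (by simpa using hx)
    exact ⟨mapElt F (sq.lift a b hab) γ, by rw [← mapElt_comp, sq.lift_snd]⟩

/-- The free object on `M` is the copower, its injections sending `γ` to the free generators. -/
theorem hasCopowers_of_equivalence : HasCopowers G where
  hasCoproduct M := by
    obtain ⟨P, ι, h₁, h₂⟩ := exists_free_object F M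
    choose j hj using fun m => hG P (ι m)
    choose d hd using fun s : Cofan (fun _ : M => G) => h₁ s.pt fun m => mapElt F (s.inj m) γ
    refine ⟨⟨Cofan.mk P j, Cofan.IsColimit.mk _ d (fun s m => hγ ?_) fun s f hf => ?_⟩⟩
    · rw [mapElt_comp]
      exact (congrArg _ (hj m)).trans (hd s m)
    · refine hom_ext_of_generators F h₂ fun m => (Eq.trans ?_ (hd s m).symm)
      rw [← hj m, ← mapElt_comp]
      exact congrArg (fun k => mapElt F k γ) (hf m)

theorem isStrongGen_of_equivalence [HasCopowers G] : IsStrongGen G := fun X =>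
  extremalEpi_of_surjective hG hγ _ fun x => by
    obtain ⟨g, rfl⟩ := hG X x
    exact ⟨mapElt F (Sigma.ι (fun _ : (G ⟶ X) => G) g) γ, by
      rw [← mapElt_comp, ι_canonicalMor]⟩

/-- Surjectivity of `e` lifts the image of the generator, and freeness extends the lift. -/
theorem isRegularProjective_of_equivalence : IsRegularProjective G := fun X Y e he g => by
  obtain ⟨x, hx⟩ := surjective_of_isRegularEpi (F := F) e he (mapElt F g γ)
  obtain ⟨h, rfl⟩ := hG X x
  exact ⟨h, hγ (by simpa using hx)⟩

/-- Elements of a copower are terms in the generators. -/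
theorem exists_term_of_copower [HasCopowers G] {M : Type v}
    (x : (F.obj (copower G M)).carrier) :
    ∃ t : L.Term M, t.realize (fun m => mapElt F (Sigma.ι (fun _ : M => G) m) γ) = x := by
  obtain ⟨P, ι, h₁, h₂⟩ := exists_free_object F M
  choose j hj using fun m => hG P (ι m)
  obtain ⟨φ, hφ⟩ := h₁ (copower G M) fun m => mapElt F (Sigma.ι (fun _ : M => G) m) γ
  -- It is enough that the copower is a retract of the free object: `φ` carries terms in the free
  -- generators to terms in the copies of `γ`.
  have hid : Sigma.desc j ≫ φ = 𝟙 (copower G M) := by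
    apply Sigma.hom_ext
    intro m
    apply hγ
    rw [← Category.assoc, Sigma.ι_desc, mapElt_comp, hj, hφ, Category.comp_id]
  obtain ⟨t, ht⟩ := h₂ (mapElt F (Sigma.desc j) x)
  refine ⟨t, ?_⟩
  have := congrArg (mapElt F φ) ht
  rw [← mapElt_comp, hid, mapElt_id, mapElt_realize] at this
  rw [← this]
  congr 1
  exact funext fun m => (hφ m).symm

/-- The image of the generator is a term, and the variables occurring in it form the required finite
subset. -/
theorem isAbstractlyFinite_of_equivalence [HasCopowers G] : IsAbstractlyFinite G := fun M f => by
  classical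
  obtain ⟨t, ht⟩ := exists_term_of_copower hG hγ (mapElt F f γ)
  obtain ⟨g, hg⟩ := hG (copower G {x // x ∈ t.varFinset})
    ((t.restrictVar id).realize fun m => mapElt F (Sigma.ι (fun _ => G) m) γ)
  refine ⟨t.varFinset, g, hγ ?_⟩
  rw [mapElt_comp, hg, ← ht, mapElt_realize]
  refine FirstOrder.Language.Term.realize_restrictVar _ fun m => ?_
  rw [← mapElt_comp]
  simp [copowerMap]

end Equivalent

theorem isBarrExact_and_exists_isVarietalGenerator {K : Type u} [Category.{v} K]
    (h : IsEquivalentToVariety K) : IsBarrExact K ∧ ∃ G : K, IsVarietalGenerator G := by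
  obtain ⟨L, hL, E, ⟨e⟩⟩ := h
  obtain ⟨G, ι, h₁, h₂⟩ := exists_free_object e.functor PUnit.{v + 1}
  have hG : IsFreeOn e.functor (ι ⟨⟩) := fun X x => by
    obtain ⟨f, hf⟩ := h₁ X fun _ => x
    exact ⟨f, hf _⟩
  have hγ : ∀ {X : K} {f g : G ⟶ X}, mapElt e.functor f (ι ⟨⟩) = mapElt e.functor g (ι ⟨⟩) →
      f = g := fun h => hom_ext_of_generators e.functor h₂ fun _ => h
  have := hasCopowers_of_equivalence hG hγ
  exact ⟨isBarrExact_of_equivalence hG hγ, G, this, isStrongGen_of_equivalence hG hγ,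
    isAbstractlyFinite_of_equivalence hG hγ, isRegularProjective_of_equivalence hG hγ⟩

end VarietyChar

theorem theoremT (K : Type u) [Category.{v} K] :
    VarietyChar.IsEquivalentToVariety K ↔
      VarietyChar.IsBarrExact K ∧ ∃ G : K, VarietyChar.IsVarietalGenerator G :=
  ⟨VarietyChar.isBarrExact_and_exists_isVarietalGenerator, fun ⟨hK, _, hG⟩ =>
    VarietyChar.isEquivalentToVariety_of_isVarietalGenerator hK hG⟩
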